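/- **Model.** Let $G=(V,E)$ be a finite simple graph with $n=|V|$ vertices (task types), and let $W\in\{0,1\}^{V\times V}$ be its unit-weight coefficient matrix: $W_{u,v}=1$ if $u=v$ or $\{u,v\}\in E$, and $W_{u,v}=0$ otherwise. For $\boldsymbol\theta\in\mathbb{R}^V$ put $u_v(\boldsymbol\theta)=\sum_{v'}W_{v,v'}\theta_{v'}$, and let $\mathsf{OPT}(G)=\min\{\sum_v\theta_v : \boldsymbol\theta\ge\mathbf 0,\ u_v(\boldsymbol\theta)\ge 1\ \forall v\}$. There are $n$ agents; agent $i$ has type $t_i$, where the type profile $\boldsymbol t$ is a uniformly random bijection from agents to $V$. A *signaling scheme* consists of a finite signal space $\mathcal S\subset[0,1]$ and a map $\varphi$ assigning to every type profile $\boldsymbol t$ a probability distribution $\varphi(\boldsymbol t)$ on $\mathcal S^V$; when $\boldsymbol s\sim\varphi(\boldsymbol t)$ is drawn, agent $i$ privately receives $s_{t_i}$. The scheme is *persuasive* if for every agent $i$ and every $\theta\in\mathcal S$ that agent $i$ receives with positive probability, the posterior expectation given $s_{t_i}=\theta$ satisfies $\mathbb{E}[u_{t_i}(\theta,\boldsymbol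 s_{-t_i})\mid s_{t_i}=\theta]\ge1$ and $\theta=\min\{x\ge0 : \mathbb{E}[u_{t_i}(x,\boldsymbol s_{-t_i})\mid s_{t_i}=\theta]\ge1\}$. Its *cost* is the expected total workload $\mathbb{E}_{\boldsymbol t,\ \boldsymbol s\sim\varphi(\boldsymbol t)}\big[\sum_v s_v\big]$. It is *binary* if $\mathcal S=\{0,\alpha\}$ for some $\alpha\in(0,1]$. **Theorem.** 1. There is a universal constant $C>0$ such that for every finite simple graph $G$ on $n$ vertices there is a persuasive binary signaling scheme with cost at most $C\sqrt n\cdot\mathsf{OPT}(G)$. 2. The ratio is tight. For $k\ge1$ let the double star be the graph on $n=2k+2$ vertices consisting of two stars with $k$ leaves each, whose two centers are joined by an edge. Then $\mathsf{OPT}=2$ on the double star, and there is a universal constant $c>0$ such that for every $k\ge1$ every persuasive signaling scheme on it (with any finite signal space $\mathcal S\subset[0,1]$) has cost at least $c\sqrt n$. -/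

import Mathlib

open scoped Matrix

universe u

noncomputable section

namespace Collab

open Classical in
/-- The coefficient matrix of the unit-weight collaboration graph `G`: ones on the diagonal, one
for every edge and zero for every non-adjacent pair. -/
def unitWeights {V : Type u} (G : SimpleGraph V) : Matrix V V ℝ :=
  fun v v' => if v = v' ∨ G.Adj v v' then 1 else 0

section Benchmark

variable {V : Type u} [Fintype V]

/-- The total contribution `u_v(θ) = ∑ v', W v v' * θ v'` entering a type-`v` task. -/
def contribution (W : Matrix V V ℝ) (θ : V → ℝ) (v : V) : ℝ := (W *ᵥ θ) v

/-- The nonnegative effort vectors under which every task receives at least one unit of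
contribution. -/
def feasible (W : Matrix V V ℝ) : Set (V → ℝ) :=
  {θ | (∀ v, 0 ≤ θ v) ∧ ∀ v, 1 ≤ contribution W θ v}

/-- The socially optimal total workload, the value of the linear program
`min ‖θ‖₁` over feasible `θ`. -/
def OPT (W : Matrix V V ℝ) : ℝ := sInf ((fun θ : V → ℝ => ∑ v, θ v) '' feasible W)

end Benchmark

/-- A signaling scheme `φ : Sym(V) → Δ(𝒮^V)` over a finite signal space `𝒮 ⊆ [0,1]`. There are as
many agents as task types, so the agents are labelled by `V` as well: under the type profile
`t : Equiv.Perm V`, agent `i` has type `t i`. A signal vector `s : V → 𝒮` sends `s v` to the agent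
of type `v`, that is, `s (t i)` to agent `i`. -/
structure SignalingScheme (V : Type u) [Fintype V] [DecidableEq V] where
  /-- the finite signal space -/
  signals : Finset ℝ
  signals_mem : ∀ x ∈ signals, x ∈ Set.Icc (0 : ℝ) 1
  /-- `dist t s` is the probability of sending `s` when the type profile is `t` -/
  dist : Equiv.Perm V → (V → signals) → ℝ
  dist_mem : ∀ t, dist t ∈ stdSimplex ℝ (V → signals)

namespace SignalingScheme

variable {V : Type u} [Fintype V] [DecidableEq V]

/-- The joint probability of a type profile, drawn uniformly from `Sym(V)`, and a signal vector. -/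
def joint (φ : SignalingScheme V) (t : Equiv.Perm V) (s : V → φ.signals) : ℝ :=
  (Fintype.card (Equiv.Perm V) : ℝ)⁻¹ * φ.dist t s

/-- The probability that agent `i` receives the signal `θ`. -/
def signalProb (φ : SignalingScheme V) (i : V) (θ : φ.signals) : ℝ :=
  ∑ t : Equiv.Perm V, ∑ s : V → φ.signals, if s (t i) = θ then φ.joint t s else 0

/-- The posterior belief of agent `i` about the type profile and the signals, conditioned on
receiving `θ` (Bayes' rule; meaningful when `0 < φ.signalProb i θ`). -/
def posterior (φ : SignalingScheme V) (i : V) (θ : φ.signals)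
    (t : Equiv.Perm V) (s : V → φ.signals) : ℝ :=
  (if s (t i) = θ then φ.joint t s else 0) / φ.signalProb i θ

/-- The posterior expectation of `u_{t_i}(x, s_{-t_i})` for agent `i` who has received `θ` and
contributes `x`, while all the other agents follow their signals. -/
def expectedQuality (φ : SignalingScheme V) (W : Matrix V V ℝ) (i : V) (θ : φ.signals)
    (x : ℝ) : ℝ :=
  ∑ t : Equiv.Perm V, ∑ s : V → φ.signals, φ.posterior i θ t s *
    contribution W (Function.update (fun v => (s v : ℝ)) (t i) x) (t i)

/-- Persuasiveness: for every agent `i` and every signal `θ` that agent `i` receives with positive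
probability, contributing `θ` is feasible in expectation, and `θ` is the least nonnegative
contribution that is feasible in expectation. -/
def Persuasive (φ : SignalingScheme V) (W : Matrix V V ℝ) : Prop :=
  ∀ (i : V) (θ : φ.signals), 0 < φ.signalProb i θ →
    1 ≤ φ.expectedQuality W i θ θ ∧
      IsLeast {x : ℝ | 0 ≤ x ∧ 1 ≤ φ.expectedQuality W i θ x} θ

/-- The expected total workload when all agents follow their signals. -/
def cost (φ : SignalingScheme V) : ℝ :=
  ∑ t : Equiv.Perm V, ∑ s : V → φ.signals, φ.joint t s * ∑ v, (s v : ℝ)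

/-- Binary schemes: the signal space is `{0, α}` with `α ∈ (0, 1]`. -/
def IsBinary (φ : SignalingScheme V) : Prop :=
  ∃ α : ℝ, 0 < α ∧ α ≤ 1 ∧ φ.signals = {0, α}

end SignalingScheme

/-- The `2 * k + 2` vertices of the double star: `(i, none)` is the center of the `i`-th star and
`(i, some j)` is its `j`-th leaf. -/
abbrev DoubleStarVertex (k : ℕ) : Type := Fin 2 × Option (Fin k)

/-- The double star: the two centers are adjacent, and each leaf is adjacent to the center of its
own star only. -/
def doubleStar (k : ℕ) : SimpleGraph (DoubleStarVertex k) where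
  Adj p q := p ≠ q ∧
    ((p.2 = none ∧ q.2 = none) ∨ (p.1 = q.1 ∧ (p.2 = none ∨ q.2 = none)))
  symm := ⟨by
    rintro p q ⟨hne, h⟩
    refine ⟨hne.symm, ?_⟩
    rcases h with ⟨hp, hq⟩ | ⟨he, h⟩
    · exact Or.inl ⟨hq, hp⟩
    · exact Or.inr ⟨he.symm, h.symm⟩⟩
  loopless := ⟨fun _ h => h.1 rfl⟩

end Collab

end

/-!
Write `W` for the unit weights, `n` for the number of vertices and `K` for the total weight of a
fractional dominating vector. Persuasiveness is linear once it is multiplied by the probability of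
the signal: the excess `𝔼[(u_{t_i}(s) - 1); s_{t_i} = θ]` is nonnegative, and it vanishes for
`θ > 0`, because lowering one's own effort by `ε` lowers the quality by exactly `ε`
(`SignalingScheme.persuasive_iff`).

Upper bound. The scheme ignores the type profile and mixes two vertex sets, telling members `α` and
non-members `0` (`exists_binary_of_two_sets`). Mostly it uses a set `S` of at most `K + 1` vertices
of largest degree; by fractional knapsack their closed neighbourhoods have total size at least `n`,
so the zero signal would be served, were it not for the edges inside `S`, which waste weight and
force `α < 1`. With a small probability `p` it uses a maximal independent set `T`, which repairs
both defects. It dilutes the weight inside `S`, at most `4 K ^ 2`, by the workload `p |T|`, which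
brings `1 - α` down to `K / √n`. It also has slack: `T` sends at least `n - K` into its complement,
although only `n - |T|` is needed (`le_weightBetween_compl`), since the vector of weight `K` has to
dominate every vertex of `T`. Taking `p |T| = 4 K √n` balances the two (`mixture_arith`); if
`|T| ≤ 4 K √n`, then `T` alone is good enough.

Lower bound. Averaging the excess over all agents against a function `g` of the signal gives linear
constraints on the law of the signals (`SignalingScheme.expect_sum_excess`). On the double star
`g = 1` shows that the centers' signals fall short of one by `O(cost / k)` in expectation. If `g`
is the indicator of `[1 - δ, 1]`, the centers have excess about `2`, each of them receiving the
effort of the other one, and this must be compensated by leaves with a signal at least `1 - δ`,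
each with deficit at most `δ`; hence `δ * cost` is bounded below unless the shortfall `cost / k` is
of order `δ`. With `δ` of order `1 / √k` both cases give `cost ≥ c √k`.
-/

namespace Collab

noncomputable section

/-! ### Linear form of persuasiveness -/

namespace SignalingScheme

variable {V : Type u} [Fintype V] [DecidableEq V]

/-- The unnormalised conditional excess of agent `i` at the signal `θ`: the expectation of
`u_{t_i}(s) - 1` on the event that agent `i` receives `θ`. -/
def excess (φ : SignalingScheme V) (W : Matrix V V ℝ) (i : V) (θ : φ.signals) : ℝ :=
  ∑ t : Equiv.Perm V, ∑ s : V → φ.signals, if s (t i) = θ then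
    φ.joint t s * (contribution W (fun v => (s v : ℝ)) (t i) - 1) else 0

/-- The expectation of a function of the signal vector, over the type profile and the scheme. -/
def expect (φ : SignalingScheme V) (f : (V → φ.signals) → ℝ) : ℝ :=
  ∑ t : Equiv.Perm V, ∑ s : V → φ.signals, φ.joint t s * f s

lemma joint_nonneg (φ : SignalingScheme V) (t : Equiv.Perm V) (s : V → φ.signals) :
    0 ≤ φ.joint t s :=
  mul_nonneg (by positivity) ((φ.dist_mem t).1 s)

lemma expect_one (φ : SignalingScheme V) : φ.expect (fun _ => 1) = 1 := by
  have h (t : Equiv.Perm V) : ∑ s, φ.dist t s = 1 := (φ.dist_mem t).2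
  simp only [expect, joint, mul_one, ← Finset.mul_sum, h, Finset.sum_const, Finset.card_univ,
    nsmul_eq_mul]
  have hN : (Fintype.card (Equiv.Perm V) : ℝ) ≠ 0 := Nat.cast_ne_zero.mpr Fintype.card_ne_zero
  exact mul_inv_cancel₀ hN

lemma expect_mono (φ : SignalingScheme V) {f g : (V → φ.signals) → ℝ} (h : ∀ s, f s ≤ g s) :
    φ.expect f ≤ φ.expect g :=
  Finset.sum_le_sum fun t _ => Finset.sum_le_sum fun s _ =>
    mul_le_mul_of_nonneg_left (h s) (φ.joint_nonneg t s)

lemma expect_add (φ : SignalingScheme V) (f g : (V → φ.signals) → ℝ) :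
    φ.expect (fun s => f s + g s) = φ.expect f + φ.expect g := by
  simp only [expect, mul_add, Finset.sum_add_distrib]

lemma expect_const_mul (φ : SignalingScheme V) (c : ℝ) (f : (V → φ.signals) → ℝ) :
    φ.expect (fun s => c * f s) = c * φ.expect f := by
  simp only [expect, mul_left_comm _ c, Finset.mul_sum]

lemma cost_eq_expect (φ : SignalingScheme V) : φ.cost = φ.expect fun s => ∑ v, (s v : ℝ) := rfl

lemma contribution_update {W : Matrix V V ℝ} (hW : ∀ v, W v v = 1) (f : V → ℝ) (v : V) (x : ℝ) :
    contribution W (Function.update f v x) v = x - f v + contribution W f v := by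
  have h : Function.update f v x = f + (x - f v) • Pi.single v (1 : ℝ) := by
    ext u
    by_cases hu : u = v
    · subst hu; simp
    · simp [hu]
  rw [contribution, contribution, h, Matrix.mulVec_add, Matrix.mulVec_smul]
  simp [hW]
  ring

/-- Since an agent's own effort counts with weight one, deviating from `θ` to `x` changes the
expected quality by exactly `x - θ`. -/
lemma expectedQuality_mul_signalProb (φ : SignalingScheme V) {W : Matrix V V ℝ}
    (hW : ∀ v, W v v = 1) (i : V) (θ : φ.signals) (hp : 0 < φ.signalProb i θ) (x : ℝ) :
    (φ.expectedQuality W i θ x - 1) * φ.signalProb i θ =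
      (x - θ) * φ.signalProb i θ + φ.excess W i θ := by
  have h1 : φ.expectedQuality W i θ x * φ.signalProb i θ =
      (x - θ) * φ.signalProb i θ + (φ.signalProb i θ + φ.excess W i θ) := by
    rw [expectedQuality, Finset.sum_mul]
    nth_rewrite 2 [signalProb]
    nth_rewrite 2 [signalProb]
    rw [excess, Finset.mul_sum, ← Finset.sum_add_distrib, ← Finset.sum_add_distrib]
    refine Finset.sum_congr rfl fun t _ => ?_
    rw [Finset.sum_mul, Finset.mul_sum, ← Finset.sum_add_distrib, ← Finset.sum_add_distrib]
    refine Finset.sum_congr rfl fun s _ => ?_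
    rw [posterior]
    split_ifs with h
    · rw [contribution_update hW, h]
      field_simp
      ring
    · simp
  linarith

lemma excess_eq_zero_of_signalProb (φ : SignalingScheme V) (W : Matrix V V ℝ) (i : V)
    (θ : φ.signals) (hp : ¬ 0 < φ.signalProb i θ) : φ.excess W i θ = 0 := by
  have hnn (t : Equiv.Perm V) (s : V → φ.signals) :
      0 ≤ if s (t i) = θ then φ.joint t s else 0 := by
    split_ifs
    · exact φ.joint_nonneg t s
    · exact le_rfl
  have h0 : φ.signalProb i θ = 0 := le_antisymm (not_lt.mp hp)
    (Finset.sum_nonneg fun t _ => Finset.sum_nonneg fun s _ => hnn t s)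
  refine Finset.sum_eq_zero fun t _ => Finset.sum_eq_zero fun s _ => ?_
  have h1 := (Finset.sum_eq_zero_iff_of_nonneg
    fun t _ => Finset.sum_nonneg fun s _ => hnn t s).mp h0 t (Finset.mem_univ _)
  have h2 := (Finset.sum_eq_zero_iff_of_nonneg fun s _ => hnn t s).mp h1 s (Finset.mem_univ _)
  split_ifs with h
  · rw [if_pos h] at h2
    rw [h2, zero_mul]
  · rfl

/-- Persuasiveness in linear form: no signal has negative excess, and the positive signals, which
could otherwise be lowered, have excess zero. -/
lemma persuasive_iff (φ : SignalingScheme V) {W : Matrix V V ℝ} (hW : ∀ v, W v v = 1) :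
    φ.Persuasive W ↔
      ∀ i (θ : φ.signals), 0 ≤ φ.excess W i θ ∧ (0 < (θ : ℝ) → φ.excess W i θ = 0) := by
  refine forall₂_congr fun i θ => ?_
  have hθ : 0 ≤ (θ : ℝ) := (φ.signals_mem θ θ.2).1
  by_cases hp : 0 < φ.signalProb i θ
  · have key (x : ℝ) : 1 ≤ φ.expectedQuality W i θ x ↔
        0 ≤ (x - θ) * φ.signalProb i θ + φ.excess W i θ := by
      rw [← φ.expectedQuality_mul_signalProb hW i θ hp, mul_nonneg_iff_of_pos_right hp, sub_nonneg]
    simp only [hp, forall_const, key, sub_self, zero_mul, zero_add]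
    constructor
    · rintro ⟨h0, -, hl⟩
      refine ⟨h0, fun hpos => le_antisymm (not_lt.mp fun hlt => ?_) h0⟩
      -- a positive excess would allow a slightly smaller effort
      have hm := hl (a := max 0 (θ - φ.excess W i θ / φ.signalProb i θ)) ⟨le_max_left _ _, by
        have h3 := le_max_right 0 (θ - φ.excess W i θ / φ.signalProb i θ)
        have h4 : (-(φ.excess W i θ / φ.signalProb i θ)) * φ.signalProb i θ =
          - φ.excess W i θ := by field_simp
        nlinarith⟩
      have : 0 < φ.excess W i θ / φ.signalProb i θ := div_pos hlt hp
      rcases le_max_iff.mp hm with h | h <;> linarith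
    · rintro ⟨h0, h1⟩
      refine ⟨h0, ⟨hθ, by simpa using h0⟩, fun x ⟨hx, hx'⟩ => ?_⟩
      rcases hθ.eq_or_lt with h | h
      · rwa [← h]
      · rw [h1 h, add_zero, mul_nonneg_iff_of_pos_right hp] at hx'
        linarith
  · simp [hp, φ.excess_eq_zero_of_signalProb W i θ hp]

/-- Averaging the conditional excesses against a test function `g` of the signal removes the
agents and the type profile from the picture. -/
lemma expect_sum_excess (φ : SignalingScheme V) (W : Matrix V V ℝ) (g : ℝ → ℝ) :
    φ.expect (fun s => ∑ v, (contribution W (fun v => (s v : ℝ)) v - 1) * g (s v)) =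
      ∑ i, ∑ θ : φ.signals, g θ * φ.excess W i θ := by
  have h (i : V) : ∑ θ : φ.signals, g θ * φ.excess W i θ =
      ∑ t : Equiv.Perm V, ∑ s : V → φ.signals, φ.joint t s *
        ((contribution W (fun v => (s v : ℝ)) (t i) - 1) * g (s (t i))) := by
    simp only [excess, Finset.mul_sum]
    rw [Finset.sum_comm]
    refine Finset.sum_congr rfl fun t _ => ?_
    rw [Finset.sum_comm]
    refine Finset.sum_congr rfl fun s _ => ?_
    simp only [mul_ite, mul_zero, Finset.sum_ite_eq, Finset.mem_univ, if_true]
    ring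
  simp only [h, expect]
  symm
  rw [Finset.sum_comm]
  refine Finset.sum_congr rfl fun t _ => ?_
  rw [Finset.sum_comm]
  refine Finset.sum_congr rfl fun s _ => ?_
  rw [← Finset.mul_sum]
  congr 1
  exact Equiv.sum_comp t fun v => (contribution W (fun v => (s v : ℝ)) v - 1) * g (s v)

lemma Persuasive.expect_nonneg {φ : SignalingScheme V} {W : Matrix V V ℝ} (hφ : φ.Persuasive W)
    (hW : ∀ v, W v v = 1) :
    0 ≤ φ.expect (fun s => ∑ v, (contribution W (fun v => (s v : ℝ)) v - 1)) := by
  have h := φ.expect_sum_excess W fun _ => 1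
  simp only [mul_one, one_mul] at h
  rw [h]
  exact Finset.sum_nonneg fun i _ => Finset.sum_nonneg fun θ _ =>
    ((φ.persuasive_iff hW).mp hφ i θ).1

lemma Persuasive.expect_eq_zero {φ : SignalingScheme V} {W : Matrix V V ℝ} (hφ : φ.Persuasive W)
    (hW : ∀ v, W v v = 1) {g : ℝ → ℝ} (hg : g 0 = 0) :
    φ.expect (fun s => ∑ v, (contribution W (fun v => (s v : ℝ)) v - 1) * g (s v)) = 0 := by
  rw [φ.expect_sum_excess W g]
  refine Finset.sum_eq_zero fun i _ => Finset.sum_eq_zero fun θ _ => ?_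
  rcases (φ.signals_mem θ θ.2).1.eq_or_lt with h | h
  · rw [← h, hg, zero_mul]
  · rw [((φ.persuasive_iff hW).mp hφ i θ).2 h, mul_zero]

end SignalingScheme

/-! ### Schemes that mix two vertex sets -/

section TwoSets

variable {V : Type u} [Fintype V] [DecidableEq V]

/-- The total weight `∑ v ∈ A, ∑ u ∈ B, W v u` that the vertices of `A` receive from those
of `B`. -/
def weightBetween (W : Matrix V V ℝ) (A B : Finset V) : ℝ := ∑ v ∈ A, ∑ u ∈ B, W v u

/-- Under a uniformly random bijection every type is equally likely for every agent. -/
lemma card_mul_sum_perm_apply (f : V → ℝ) (i : V) :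
    (Fintype.card V : ℝ) * ∑ t : Equiv.Perm V, f (t i) =
      (Fintype.card (Equiv.Perm V) : ℝ) * ∑ v, f v := by
  have h (j : V) : ∑ t : Equiv.Perm V, f (t j) = ∑ t : Equiv.Perm V, f (t i) := by
    rw [← Equiv.sum_comp (Equiv.mulRight (Equiv.swap i j))]
    simp
  have h2 : ∑ j, ∑ t : Equiv.Perm V, f (t j) =
      (Fintype.card V : ℝ) * ∑ t : Equiv.Perm V, f (t i) := by
    simp [h]
  rw [← h2, Finset.sum_comm]
  simp [Equiv.sum_comp]

lemma contribution_indicator (W : Matrix V V ℝ) (A : Finset V) (α : ℝ) (v : V) :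
    contribution W (fun u => if u ∈ A then α else 0) v = α * ∑ u ∈ A, W v u := by
  simp [contribution, Matrix.mulVec, dotProduct, Finset.mul_sum, mul_comm]

/-- A convex combination of two vertex sets `S` and `T`, whose members are told `α` and whose
non-members are told `0`, is a persuasive binary scheme as soon as the signal `α` is met with
equality and the signal `0` with inequality, on average over both sets. -/
lemma exists_binary_of_two_sets {W : Matrix V V ℝ} (hW : ∀ v, W v v = 1) (S T : Finset V)
    {p α : ℝ} (hp0 : 0 ≤ p) (hp1 : p ≤ 1) (hα0 : 0 < α) (hα1 : α ≤ 1)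
    (hpos : (1 - p) * (α * weightBetween W S S - S.card) +
      p * (α * weightBetween W T T - T.card) = 0)
    (hzero : 0 ≤ (1 - p) * (α * weightBetween W Sᶜ S - Sᶜ.card) +
      p * (α * weightBetween W Tᶜ T - Tᶜ.card)) :
    ∃ φ : SignalingScheme V, φ.IsBinary ∧ φ.Persuasive W ∧
      φ.cost = α * ((1 - p) * S.card + p * T.card) := by
  set sig : Finset ℝ := {0, α} with hsig
  let vec (A : Finset V) : V → sig := fun v =>
    if v ∈ A then ⟨α, by simp [hsig]⟩ else ⟨0, by simp [hsig]⟩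
  have hvec (A : Finset V) (v : V) : (vec A v : ℝ) = if v ∈ A then α else 0 := by
    simp only [vec]; split_ifs <;> rfl
  let D : (V → sig) → ℝ := (1 - p) • Pi.single (vec S) 1 + p • Pi.single (vec T) 1
  have hD (f : (V → sig) → ℝ) : ∑ s, D s * f s = (1 - p) * f (vec S) + p * f (vec T) := by
    simp [D, add_mul, Finset.sum_add_distrib, Pi.single_apply]
  let φ : SignalingScheme V :=
    { signals := sig
      signals_mem := by
        intro x hx
        rcases Finset.mem_insert.mp hx with rfl | hx
        · exact ⟨le_rfl, zero_le_one⟩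
        · rw [Finset.mem_singleton.mp hx]; exact ⟨hα0.le, hα1⟩
      dist := fun _ => D
      dist_mem := fun _ => convex_stdSimplex ℝ _ (single_mem_stdSimplex ℝ _)
        (single_mem_stdSimplex ℝ _) (by linarith) hp0 (by ring) }
  have hN : (Fintype.card (Equiv.Perm V) : ℝ) ≠ 0 := Nat.cast_ne_zero.mpr Fintype.card_ne_zero
  refine ⟨φ, ⟨α, hα0, hα1, rfl⟩, (φ.persuasive_iff hW).mpr fun i θ => ?_, ?_⟩
  · let e (A : Finset V) (v : V) : ℝ := if vec A v = θ then
      contribution W (fun v => (vec A v : ℝ)) v - 1 else 0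
    have hexc : (Fintype.card V : ℝ) * φ.excess W i θ =
        (1 - p) * ∑ v, e S v + p * ∑ v, e T v := by
      have h1 (t : Equiv.Perm V) : (∑ s : V → φ.signals, if s (t i) = θ then
          φ.joint t s * (contribution W (fun v => (s v : ℝ)) (t i) - 1) else 0) =
          (Fintype.card (Equiv.Perm V) : ℝ)⁻¹ * ((1 - p) * e S (t i) + p * e T (t i)) := by
        rw [← hD fun s => if s (t i) = θ then
          (contribution W (fun v => (s v : ℝ)) (t i) - 1) else 0, Finset.mul_sum]
        refine Finset.sum_congr rfl fun s _ => ?_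
        split_ifs
        · exact mul_assoc _ _ _
        · simp
      rw [SignalingScheme.excess, Finset.sum_congr rfl fun t _ => h1 t, ← Finset.mul_sum,
        mul_left_comm, card_mul_sum_perm_apply (fun v => (1 - p) * e S v + p * e T v) i,
        inv_mul_cancel_left₀ hN, Finset.sum_add_distrib, Finset.mul_sum, Finset.mul_sum]
    have hcard : (0 : ℝ) < Fintype.card V := Nat.cast_pos.mpr (Fintype.card_pos_iff.mpr ⟨i⟩)
    have hθ : (θ : ℝ) = 0 ∨ (θ : ℝ) = α := by
      rcases Finset.mem_insert.mp θ.2 with h | h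
      · exact Or.inl h
      · exact Or.inr (Finset.mem_singleton.mp h)
    rcases hθ with h | h
    · have he (A : Finset V) : ∑ v, e A v = α * weightBetween W Aᶜ A - Aᶜ.card := by
        have : ∀ v, e A v = if v ∈ Aᶜ then α * ∑ u ∈ A, W v u - 1 else 0 := by
          intro v
          simp only [e, Subtype.ext_iff, hvec, h, contribution_indicator, Finset.mem_compl]
          by_cases hv : v ∈ A <;> simp [hv, hα0.ne']
        simp only [this, Finset.sum_ite_mem, Finset.univ_inter, Finset.sum_sub_distrib,
          weightBetween, Finset.mul_sum, Finset.sum_const, nsmul_eq_mul, mul_one]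
      rw [he, he] at hexc
      refine ⟨?_, fun h' => absurd h h'.ne'⟩
      rw [← hexc] at hzero
      exact (mul_nonneg_iff_of_pos_left hcard).mp hzero
    · have he (A : Finset V) : ∑ v, e A v = α * weightBetween W A A - A.card := by
        have : ∀ v, e A v = if v ∈ A then α * ∑ u ∈ A, W v u - 1 else 0 := by
          intro v
          simp only [e, Subtype.ext_iff, hvec, h, contribution_indicator]
          by_cases hv : v ∈ A <;> simp [hv, hα0.ne]
        simp only [this, Finset.sum_ite_mem, Finset.univ_inter, Finset.sum_sub_distrib,
          weightBetween, Finset.mul_sum, Finset.sum_const, nsmul_eq_mul, mul_one]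
      rw [he, he, hpos] at hexc
      have h0 := (mul_eq_zero.mp hexc).resolve_left hcard.ne'
      exact ⟨h0.ge, fun _ => h0⟩
  · have h1 (t : Equiv.Perm V) : ∑ s : V → φ.signals, φ.joint t s * ∑ v, (s v : ℝ) =
        (Fintype.card (Equiv.Perm V) : ℝ)⁻¹ * (α * ((1 - p) * S.card + p * T.card)) := by
      have h2 := hD fun s => ∑ v, (s v : ℝ)
      simp only [hvec, Finset.sum_ite_mem, Finset.univ_inter, Finset.sum_const,
        nsmul_eq_mul] at h2
      rw [show α * ((1 - p) * S.card + p * T.card) =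
        (1 - p) * (S.card * α) + p * (T.card * α) by ring, ← h2, Finset.mul_sum]
      exact Finset.sum_congr rfl fun s _ => mul_assoc _ _ _
    rw [SignalingScheme.cost, Finset.sum_congr rfl fun t _ => h1 t, Finset.sum_const,
      Finset.card_univ, nsmul_eq_mul, mul_inv_cancel_left₀ hN]

end TwoSets

/-! ### Unit weights, independent sets and heavy sets -/

section UnitWeights

variable {V : Type u} (G : SimpleGraph V)

lemma unitWeights_self (v : V) : unitWeights G v v = 1 := by simp [unitWeights]

lemma unitWeights_comm (u v : V) : unitWeights G u v = unitWeights G v u := by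
  classical exact if_congr (or_congr eq_comm (G.adj_comm u v)) rfl rfl

lemma unitWeights_nonneg (u v : V) : 0 ≤ unitWeights G u v := by
  unfold unitWeights; split_ifs <;> norm_num

lemma unitWeights_le_one (u v : V) : unitWeights G u v ≤ 1 := by
  unfold unitWeights; split_ifs <;> norm_num

lemma unitWeights_eq_zero_or_one (u v : V) : unitWeights G u v = 0 ∨ unitWeights G u v = 1 := by
  unfold unitWeights; split_ifs <;> simp

lemma weightBetween_self_le (S : Finset V) :
    weightBetween (unitWeights G) S S ≤ (S.card : ℝ) ^ 2 := by
  calc weightBetween (unitWeights G) S S ≤ ∑ v ∈ S, ∑ u ∈ S, (1 : ℝ) :=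
      Finset.sum_le_sum fun v _ => Finset.sum_le_sum fun u _ => unitWeights_le_one G v u
    _ = (S.card : ℝ) ^ 2 := by simp [sq]

lemma card_le_weightBetween_self (S : Finset V) :
    (S.card : ℝ) ≤ weightBetween (unitWeights G) S S := by
  calc (S.card : ℝ) = ∑ v ∈ S, (1 : ℝ) := by simp
    _ ≤ weightBetween (unitWeights G) S S := Finset.sum_le_sum fun v hv => by
      rw [← unitWeights_self G v]
      exact Finset.single_le_sum (f := fun u => unitWeights G v u)
        (fun u _ => unitWeights_nonneg G v u) hv

variable [Fintype V]

/-- A maximum independent set: distinct members have weight zero, and every other vertex has a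
neighbour in the set. -/
lemma exists_maximal_independent : ∃ T : Finset V,
    (∀ v ∈ T, ∑ u ∈ T, unitWeights G v u = 1) ∧ ∀ v ∉ T, 1 ≤ ∑ u ∈ T, unitWeights G v u := by
  classical
  let P : Finset V → Prop := fun T => ∀ v ∈ T, ∀ u ∈ T, v ≠ u → unitWeights G v u = 0
  obtain ⟨T, hT, hmax⟩ := Finset.exists_max_image (Finset.univ.filter P) Finset.card
    ⟨∅, by simp [P]⟩
  have hT : P T := (Finset.mem_filter.mp hT).2
  refine ⟨T, fun v hv => ?_, fun v hv => ?_⟩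
  · rw [Finset.sum_eq_single_of_mem v hv fun u hu huv => hT v hv u hu huv.symm,
      unitWeights_self]
  · by_contra! hlt
    have h0 (u : V) (hu : u ∈ T) : unitWeights G v u = 0 := by
      refine (unitWeights_eq_zero_or_one G v u).resolve_right fun h => ?_
      have := Finset.single_le_sum (f := fun u => unitWeights G v u)
        (fun u _ => unitWeights_nonneg G v u) hu
      linarith
    have hins : P (insert v T) := by
      intro a ha b hb hab
      rcases Finset.mem_insert.mp ha with rfl | ha' <;>
        rcases Finset.mem_insert.mp hb with rfl | hb'
      · exact absurd rfl hab
      · exact h0 b hb'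
      · rw [unitWeights_comm]; exact h0 a ha'
      · exact hT a ha' b hb' hab
    have := hmax _ (Finset.mem_filter.mpr ⟨Finset.mem_univ _, hins⟩)
    rw [Finset.card_insert_of_notMem hv] at this
    omega

/-- Lowering every effort above one to one keeps a vector feasible for unit weights. -/
lemma exists_feasible_le_one {θ : V → ℝ} (hθ : θ ∈ feasible (unitWeights G)) :
    ∃ η ∈ feasible (unitWeights G), (∀ v, η v ≤ 1) ∧ ∑ v, η v ≤ ∑ v, θ v := by
  have hη0 (v : V) : 0 ≤ min (θ v) 1 := le_min (hθ.1 v) zero_le_one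
  refine ⟨fun v => min (θ v) 1, ⟨hη0, fun v => ?_⟩, fun v => min_le_right _ _,
    Finset.sum_le_sum fun v _ => min_le_left _ _⟩
  by_cases h : ∃ u, unitWeights G v u = 1 ∧ 1 ≤ θ u
  · obtain ⟨u, hu, hu'⟩ := h
    refine le_trans (by simp [hu, hu']) (Finset.single_le_sum
      (f := fun u => unitWeights G v u * min (θ u) 1)
      (fun u _ => mul_nonneg (unitWeights_nonneg G v u) (hη0 u)) (Finset.mem_univ u))
  · push Not at h
    refine (hθ.2 v).trans (Finset.sum_le_sum fun u _ => ?_)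
    rcases unitWeights_eq_zero_or_one G v u with hu | hu
    · simp [hu]
    · simp [hu, (h u hu).le]

/-- The complement of a maximal independent set `T` receives from `T` about `|T|` more than the
`|Tᶜ|` it needs: a fractional dominating vector of small total weight must reach all of `T`, so
its support has many edges into `T`. -/
lemma le_weightBetween_compl [DecidableEq V] {θ : V → ℝ} (hθ : θ ∈ feasible (unitWeights G))
    (hθ1 : ∀ v, θ v ≤ 1) {T : Finset V} (hT : ∀ v ∈ T, ∑ u ∈ T, unitWeights G v u = 1)
    (hT' : ∀ v ∉ T, 1 ≤ ∑ u ∈ T, unitWeights G v u) :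
    (T.card : ℝ) + Tᶜ.card - ∑ v, θ v ≤ weightBetween (unitWeights G) Tᶜ T := by
  set a : V → ℝ := fun v => ∑ u ∈ T, unitWeights G v u with ha
  have h1 : (T.card : ℝ) ≤ ∑ v, θ v * a v := by
    calc (T.card : ℝ) = ∑ v ∈ T, (1 : ℝ) := by simp
      _ ≤ ∑ v ∈ T, contribution (unitWeights G) θ v := Finset.sum_le_sum fun v _ => hθ.2 v
      _ = ∑ v, θ v * a v := by
        simp only [contribution, Matrix.mulVec, dotProduct, ha, Finset.mul_sum]
        rw [Finset.sum_comm]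
        exact Finset.sum_congr rfl fun v _ => Finset.sum_congr rfl fun u _ => by
          rw [unitWeights_comm, mul_comm]
  have h2 : ∑ v, θ v * a v ≤ ∑ v, θ v + ∑ v ∈ Tᶜ, (a v - 1) := by
    rw [← Finset.sum_add_sum_compl T fun v => θ v * a v, ← Finset.sum_add_sum_compl T θ,
      Finset.sum_congr rfl fun v hv => by rw [show a v = 1 from hT v hv, mul_one], add_assoc,
      ← Finset.sum_add_distrib]
    refine add_le_add_right (Finset.sum_le_sum fun v hv => ?_) _
    nlinarith [hT' v (Finset.mem_compl.mp hv), hθ1 v]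
  have h3 : ∑ v ∈ Tᶜ, (a v - 1) = weightBetween (unitWeights G) Tᶜ T - Tᶜ.card := by
    simp [weightBetween, ha, Finset.sum_sub_distrib]
  linarith

end UnitWeights

/-- Fractional knapsack: the `⌈∑ θ⌉` items of largest value are worth at least as much as any
fractional selection `θ`. -/
lemma exists_card_le_sum_ge {V : Type u} [Fintype V] {θ d : V → ℝ}
    (hθ0 : ∀ v, 0 ≤ θ v) (hθ1 : ∀ v, θ v ≤ 1) (hd : ∀ v, 0 ≤ d v) :
    ∃ S : Finset V, (S.card : ℝ) ≤ ∑ v, θ v + 1 ∧ ∑ v, θ v * d v ≤ ∑ v ∈ S, d v := by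
  classical
  have hK0 : 0 ≤ ∑ v, θ v := Finset.sum_nonneg fun v _ => hθ0 v
  set k := ⌈∑ v, θ v⌉₊ with hk
  have hkn : k ≤ (Finset.univ : Finset V).card := Nat.ceil_le.mpr
    ((Finset.sum_le_sum fun v _ => hθ1 v).trans (by simp))
  obtain ⟨S, hS, hmax⟩ := Finset.exists_max_image (Finset.univ.powersetCard k)
    (fun S : Finset V => ∑ v ∈ S, d v) (Finset.powersetCard_nonempty.mpr hkn)
  have hSc : S.card = k := (Finset.mem_powersetCard.mp hS).2
  have hswap (v : V) (hv : v ∈ S) (u : V) (hu : u ∉ S) : d u ≤ d v := by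
    have hu' : u ∉ S.erase v := fun h => hu (Finset.mem_of_mem_erase h)
    have h := hmax (insert u (S.erase v)) (Finset.mem_powersetCard.mpr ⟨Finset.subset_univ _, by
      rw [Finset.card_insert_of_notMem hu', Finset.card_erase_add_one hv, hSc]⟩)
    rw [Finset.sum_insert hu', ← Finset.add_sum_erase S d hv] at h
    linarith
  have hlt : (k : ℝ) < ∑ v, θ v + 1 := Nat.ceil_lt_add_one hK0
  refine ⟨S, by rw [hSc]; exact hlt.le, ?_⟩
  -- a threshold separating the values inside `S` from those outside
  obtain ⟨τ, hτ0, hτS, hτc⟩ : ∃ τ, 0 ≤ τ ∧ (∀ v ∈ S, τ ≤ d v) ∧ ∀ v ∈ Sᶜ, d v ≤ τ := by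
    rcases S.eq_empty_or_nonempty with rfl | hne
    · exact ⟨∑ v, d v, Finset.sum_nonneg fun v _ => hd v, by simp, fun v _ =>
        Finset.single_le_sum (fun v _ => hd v) (Finset.mem_univ v)⟩
    · obtain ⟨v₀, hv₀, hmin⟩ := Finset.exists_min_image S d hne
      exact ⟨d v₀, hd v₀, hmin, fun u hu => hswap v₀ hv₀ u (Finset.mem_compl.mp hu)⟩
  have h1 : ∑ v ∈ S, (1 - θ v) * τ ≤ ∑ v ∈ S, (1 - θ v) * d v :=
    Finset.sum_le_sum fun v hv =>
      mul_le_mul_of_nonneg_left (hτS v hv) (sub_nonneg.mpr (hθ1 v))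
  have h2 : ∑ v ∈ Sᶜ, θ v * d v ≤ ∑ v ∈ Sᶜ, θ v * τ :=
    Finset.sum_le_sum fun v hv => mul_le_mul_of_nonneg_left (hτc v hv) (hθ0 v)
  have h3 : ∑ v, θ v ≤ S.card := by rw [hSc]; exact Nat.le_ceil _
  rw [← Finset.sum_add_sum_compl S] at h3 ⊢
  simp only [sub_mul, one_mul, Finset.sum_sub_distrib, ← Finset.sum_mul, Finset.sum_const,
    nsmul_eq_mul] at h1 h2
  nlinarith

/-! ### The upper bound -/

section UpperBound

variable {V : Type u} [Fintype V] (G : SimpleGraph V)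

lemma weightBetween_compl_add [DecidableEq V] (W : Matrix V V ℝ) (S : Finset V) :
    weightBetween W S S + weightBetween W Sᶜ S = ∑ u ∈ S, ∑ v, W v u := by
  rw [weightBetween, weightBetween, Finset.sum_add_sum_compl, Finset.sum_comm]

/-- A set `S` of at most `∑ θ + 1` vertices of largest degree whose closed neighbourhoods have
total size at least `n`. -/
lemma exists_heavy_set [DecidableEq V] {θ : V → ℝ} (hθ : θ ∈ feasible (unitWeights G))
    (hθ1 : ∀ v, θ v ≤ 1) :
    ∃ S : Finset V, (S.card : ℝ) ≤ ∑ v, θ v + 1 ∧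
      (Fintype.card V : ℝ) ≤ weightBetween (unitWeights G) S S +
        weightBetween (unitWeights G) Sᶜ S := by
  obtain ⟨S, hS, hS'⟩ := exists_card_le_sum_ge (d := fun u => ∑ v, unitWeights G v u) hθ.1 hθ1
    fun u => Finset.sum_nonneg fun v _ => unitWeights_nonneg G v u
  refine ⟨S, hS, ?_⟩
  rw [weightBetween_compl_add]
  refine le_trans ?_ hS'
  calc (Fintype.card V : ℝ) = ∑ v : V, (1 : ℝ) := by simp
    _ ≤ ∑ v, contribution (unitWeights G) θ v := Finset.sum_le_sum fun v _ => hθ.2 v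
    _ = ∑ u, θ u * ∑ v, unitWeights G v u := by
      simp only [contribution, Matrix.mulVec, dotProduct, Finset.mul_sum]
      rw [Finset.sum_comm]
      simp only [mul_comm]

/-- The parameters of the mixture: `K` is the value of a fractional dominating vector, `s` and `b`
the size and inner weight of the heavy set, `m` the size of the maximal independent set, and
`r = √n`. The independent set is used with probability `p = 4 K r / m`; the loss `1 - α` caused by
the edges inside the heavy set is then at most `K / r`. The
three conclusions are the equation for the signal `α`, the inequality for the signal `0`, and the
bound on the cost. -/
lemma mixture_arith {n K s b m r : ℝ} (hr : r ^ 2 = n) (hr0 : 0 < r) (hK : 1 ≤ K) (hs0 : 0 ≤ s)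
    (hs : s ≤ K + 1) (hsb : s ≤ b) (hb : b ≤ s ^ 2) (hmn : m ≤ n) (hm : 4 * K * r < m) :
    ∃ p α : ℝ, 0 ≤ p ∧ p ≤ 1 ∧ 0 < α ∧ α ≤ 1 ∧
      (1 - p) * (α * b - s) + p * (α * m - m) = 0 ∧
      (1 - p) * (n - s) + p * (n - m) ≤ α * ((1 - p) * (n - b) + p * (n - K)) ∧
      α * ((1 - p) * s + p * m) ≤ 6 * (K * r) := by
  have hm0 : 0 < m := lt_trans (by positivity) hm
  set p := 4 * K * r / m with hp
  have hpm : p * m = 4 * K * r := div_mul_cancel₀ _ hm0.ne'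
  have hp0 : 0 < p := by positivity
  have hp1 : p ≤ 1 := (div_le_one hm0).mpr hm.le
  have hKr : 4 * K ≤ r := by nlinarith
  set q := 1 - p with hq
  have hq0 : 0 ≤ q := sub_nonneg.mpr hp1
  have hq1 : q ≤ 1 := by linarith
  have hb0 : 0 ≤ b := hs0.trans hsb
  have hM' : 0 < q * b + p * m := by positivity
  have hM : 0 < q * s + p * m := by positivity
  have hle : q * s + p * m ≤ q * b + p * m := by
    linarith [mul_le_mul_of_nonneg_left hsb hq0]
  set α := (q * s + p * m) / (q * b + p * m) with hα
  have hαM : α * (q * b + p * m) = q * s + p * m := div_mul_cancel₀ _ hM'.ne'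
  have hα0 : 0 < α := by positivity
  have hα1 : α ≤ 1 := (div_le_one hM').mpr hle
  have hbK : b ≤ 4 * K ^ 2 := by nlinarith
  -- the loss in `α` is at most `b / (p m)`
  have hloss : (1 - α) * (4 * r) ≤ 4 * K := by
    have h1 : (1 - α) * (q * b + p * m) ≤ b := by nlinarith
    have h2 : (1 - α) * (p * m) ≤ 4 * K ^ 2 := by
      nlinarith [mul_nonneg (sub_nonneg.mpr hα1) (mul_nonneg hq0 hb0)]
    rw [hpm] at h2
    have h3 : K * ((1 - α) * (4 * r)) ≤ K * (4 * K) := by linarith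
    exact le_of_mul_le_mul_left h3 (by linarith)
  have hlossn : (1 - α) * n ≤ K * r := by rw [← hr]; nlinarith
  refine ⟨p, α, hp0.le, hp1, hα0, hα1, by linarith, ?_, ?_⟩
  · have hZ : q * (n - b) + p * (n - K) ≤ n := by
      have : q * (n - b) + p * (n - K) = n - q * b - p * K := by rw [hq]; ring
      nlinarith [mul_nonneg hq0 hb0, mul_nonneg hp0.le (zero_le_one.trans hK)]
    have h1 : (1 - α) * (q * (n - b) + p * (n - K)) ≤ K * r :=
      (mul_le_mul_of_nonneg_left hZ (sub_nonneg.mpr hα1)).trans hlossn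
    have h2 : q * b ≤ K * r := by nlinarith [mul_nonneg hp0.le hb0]
    have h3 : p * K ≤ K := by nlinarith
    have h4 : 0 ≤ q * s := mul_nonneg hq0 hs0
    nlinarith
  · have h1 : q * s ≤ s := by nlinarith
    nlinarith

lemma le_one_sum_of_feasible [Nonempty V] {θ : V → ℝ} (hθ : θ ∈ feasible (unitWeights G)) :
    1 ≤ ∑ v, θ v := by
  obtain ⟨v⟩ := ‹Nonempty V›
  refine (hθ.2 v).trans (Finset.sum_le_sum fun u _ => ?_)
  exact mul_le_of_le_one_left (hθ.1 u) (unitWeights_le_one G v u)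

/-- Every feasible effort vector yields a binary scheme within a factor `6 √n` of it. -/
lemma exists_binary_scheme [DecidableEq V] [Nonempty V] {θ : V → ℝ}
    (hθ : θ ∈ feasible (unitWeights G)) :
    ∃ φ : SignalingScheme V, φ.IsBinary ∧ φ.Persuasive (unitWeights G) ∧
      φ.cost ≤ 6 * ((∑ v, θ v) * √(Fintype.card V : ℝ)) := by
  obtain ⟨η, hη, hη1, hηθ⟩ := exists_feasible_le_one G hθ
  refine (?_ : ∃ φ : SignalingScheme V, φ.IsBinary ∧ φ.Persuasive (unitWeights G) ∧
    φ.cost ≤ 6 * ((∑ v, η v) * √(Fintype.card V : ℝ))).imp fun φ h => ⟨h.1, h.2.1, h.2.2.trans ?_⟩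
  swap
  · gcongr
  obtain ⟨T, hT, hT'⟩ := exists_maximal_independent G
  obtain ⟨S, hS, hS'⟩ := exists_heavy_set G hη hη1
  have hslack := le_weightBetween_compl G hη hη1 hT hT'
  have hTT : weightBetween (unitWeights G) T T = T.card := by
    simp [weightBetween, Finset.sum_congr rfl hT]
  have hTc : (Tᶜ.card : ℝ) ≤ weightBetween (unitWeights G) Tᶜ T := by
    calc (Tᶜ.card : ℝ) = ∑ v ∈ Tᶜ, (1 : ℝ) := by simp
      _ ≤ _ := Finset.sum_le_sum fun v hv => hT' v (Finset.mem_compl.mp hv)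
  have hcc (A : Finset V) : (A.card : ℝ) + Aᶜ.card = Fintype.card V := by
    exact_mod_cast Finset.card_add_card_compl A
  have hn : (0 : ℝ) < Fintype.card V := Nat.cast_pos.mpr Fintype.card_pos
  have hK := le_one_sum_of_feasible G hη
  set r := √(Fintype.card V : ℝ) with hr
  have hr0 : 0 < r := Real.sqrt_pos.mpr hn
  by_cases hsmall : (T.card : ℝ) ≤ 4 * (∑ v, η v) * r
  · -- a small maximal independent set is a scheme on its own
    obtain ⟨φ, hb, hp, hc⟩ := exists_binary_of_two_sets (unitWeights_self G) S T
      (p := 1) (α := 1) zero_le_one le_rfl zero_lt_one le_rfl (by rw [hTT]; ring) (by linarith)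
    refine ⟨φ, hb, hp, ?_⟩
    rw [hc]
    nlinarith [mul_pos (lt_of_lt_of_le zero_lt_one hK) hr0]
  · obtain ⟨p, α, hp0, hp1, hα0, hα1, hpos, hzero, hcost⟩ := mixture_arith (Real.sq_sqrt hn.le)
      hr0 hK (Nat.cast_nonneg S.card) hS (card_le_weightBetween_self G S)
      (weightBetween_self_le G S) (by linarith [hcc T, (Nat.cast_nonneg Tᶜ.card : (0 : ℝ) ≤ _)])
      (not_le.mp hsmall)
    obtain ⟨φ, hb, hp, hc⟩ := exists_binary_of_two_sets (unitWeights_self G) S T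
      hp0 hp1 hα0 hα1 (by rw [hTT]; exact hpos) (by
        have h1 := mul_le_mul_of_nonneg_left (sub_le_iff_le_add'.mpr hS')
          (mul_nonneg hα0.le (sub_nonneg.mpr hp1))
        have h2 := mul_le_mul_of_nonneg_left hslack (mul_nonneg hα0.le hp0)
        rw [hcc T] at h2
        rw [eq_sub_iff_add_eq'.mpr (hcc S), eq_sub_iff_add_eq'.mpr (hcc T)]
        linarith)
    exact ⟨φ, hb, hp, hc.trans_le hcost⟩

/-- The constant `12` is twice that of `exists_binary_scheme`, applied to a feasible vector of total
below `2 * OPT`; such a vector exists since `OPT ≥ 1`, so attainment of the minimum is not needed. -/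
lemma exists_binary_scheme_cost_le [DecidableEq V] : ∃ φ : SignalingScheme V, φ.IsBinary ∧
    φ.Persuasive (unitWeights G) ∧
      φ.cost ≤ 12 * (√(Fintype.card V : ℝ) * OPT (unitWeights G)) := by
  rcases isEmpty_or_nonempty V with hV | hV
  · obtain ⟨φ, hb, hp, hc⟩ := exists_binary_of_two_sets (unitWeights_self G) ∅ ∅
      (p := 1) (α := 1) zero_le_one le_rfl zero_lt_one le_rfl
      (by simp [weightBetween]) (by simp [weightBetween, Finset.eq_empty_of_isEmpty])
    exact ⟨φ, hb, hp, by simp [hc]⟩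
  · have hone : (fun _ => 1) ∈ feasible (unitWeights G) := ⟨fun _ => zero_le_one, fun v => by
      refine le_trans (by simp [unitWeights_self]) (Finset.single_le_sum
        (f := fun u => unitWeights G v u * 1)
        (fun u _ => mul_nonneg (unitWeights_nonneg G v u) zero_le_one) (Finset.mem_univ v))⟩
    have hne : ((fun θ : V → ℝ => ∑ v, θ v) '' feasible (unitWeights G)).Nonempty :=
      ⟨_, _, hone, rfl⟩
    have hOPT : 1 ≤ OPT (unitWeights G) := le_csInf hne (by
      rintro _ ⟨θ, hθ, rfl⟩
      exact le_one_sum_of_feasible G hθ)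
    obtain ⟨_, ⟨θ, hθ, rfl⟩, hlt⟩ := exists_lt_of_csInf_lt hne
      (show sInf _ < 2 * OPT (unitWeights G) by change OPT _ < _; linarith)
    obtain ⟨φ, hb, hp, hc⟩ := exists_binary_scheme G hθ
    refine ⟨φ, hb, hp, hc.trans ?_⟩
    nlinarith [mul_le_mul_of_nonneg_right hlt.le (Real.sqrt_nonneg (Fintype.card V : ℝ))]

end UpperBound

/-! ### The double star -/

section DoubleStar

variable {k : ℕ}

lemma sum_doubleStarVertex (f : DoubleStarVertex k → ℝ) :
    ∑ v, f v = f (0, none) + f (1, none) + (∑ j, f (0, some j) + ∑ j, f (1, some j)) := by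
  simp only [Fintype.sum_prod_type, Fintype.sum_option, Fin.sum_univ_two]
  ring

lemma contribution_center (f : DoubleStarVertex k → ℝ) (i : Fin 2) :
    contribution (unitWeights (doubleStar k)) f (i, none) =
      f (0, none) + f (1, none) + ∑ j, f (i, some j) := by
  fin_cases i <;>
    simp [contribution, Matrix.mulVec, dotProduct, sum_doubleStarVertex, unitWeights, doubleStar]

lemma contribution_leaf (f : DoubleStarVertex k → ℝ) (i : Fin 2) (j : Fin k) :
    contribution (unitWeights (doubleStar k)) f (i, some j) = f (i, none) + f (i, some j) := by
  fin_cases i <;>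
    simp [contribution, Matrix.mulVec, dotProduct, sum_doubleStarVertex, unitWeights, doubleStar]

lemma OPT_doubleStar (hk : 1 ≤ k) : OPT (unitWeights (doubleStar k)) = 2 := by
  refine IsLeast.csInf_eq ⟨⟨fun v => if v.2 = none then 1 else 0, ⟨fun v => ?_, fun v => ?_⟩, ?_⟩,
    ?_⟩
  · dsimp only
    split_ifs <;> norm_num
  · obtain ⟨i, _ | j⟩ := v
    · rw [contribution_center]; simp
    · rw [contribution_leaf]; simp
  · dsimp only
    rw [sum_doubleStarVertex]
    simp
    norm_num
  · rintro _ ⟨θ, hθ, rfl⟩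
    have h0 := hθ.2 (0, some ⟨0, hk⟩)
    have h1 := hθ.2 (1, some ⟨0, hk⟩)
    rw [contribution_leaf] at h0 h1
    have hs (i : Fin 2) : θ (i, some ⟨0, hk⟩) ≤ ∑ j, θ (i, some j) :=
      Finset.single_le_sum (f := fun j => θ (i, some j)) (fun j _ => hθ.1 _) (Finset.mem_univ _)
    dsimp only
    rw [sum_doubleStarVertex]
    linarith [hs 0, hs 1]

lemma sum_contribution_sub_one (f : DoubleStarVertex k → ℝ) :
    ∑ v, (contribution (unitWeights (doubleStar k)) f v - 1) =
      (k + 2) * (f (0, none) + f (1, none)) +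
        2 * (∑ j, f (0, some j) + ∑ j, f (1, some j)) - (2 * k + 2) := by
  rw [sum_doubleStarVertex]
  simp only [contribution_center, contribution_leaf, Finset.sum_sub_distrib,
    Finset.sum_add_distrib, Finset.sum_const, Finset.card_univ, Fintype.card_fin, nsmul_eq_mul]
  ring

/-- Tested against the signals in `[1 - δ, 1]`, the excess of the two centers is close to `2` when
both centers are sent nearly `1`, while a leaf has deficit at most `δ`, and only if its own signal
is at least `1 - δ`. -/
lemma le_sum_excess_high {f : DoubleStarVertex k → ℝ} (hf0 : ∀ v, 0 ≤ f v) (hf1 : ∀ v, f v ≤ 1)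
    {δ : ℝ} (hδ0 : 0 < δ) (hδ : δ ≤ 1 / 2) :
    2 - 2 / δ * (2 - (f (0, none) + f (1, none))) - 2 * δ * ∑ v, f v ≤
      ∑ v, (contribution (unitWeights (doubleStar k)) f v - 1) *
        if 1 - δ ≤ f v then 1 else 0 := by
  have hleaf (i : Fin 2) (j : Fin k) : -(2 * δ * f (i, some j)) ≤
      (contribution (unitWeights (doubleStar k)) f (i, some j) - 1) *
        if 1 - δ ≤ f (i, some j) then 1 else 0 := by
    rw [contribution_leaf]
    have h0 := hf0 (i, none)
    have h1 := hf0 (i, some j)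
    split_ifs with h
    · nlinarith
    · nlinarith
  have hleaves (i : Fin 2) : -(2 * δ * ∑ j, f (i, some j)) ≤
      ∑ j, (contribution (unitWeights (doubleStar k)) f (i, some j) - 1) *
        if 1 - δ ≤ f (i, some j) then 1 else 0 := by
    rw [Finset.mul_sum, ← Finset.sum_neg_distrib]
    exact Finset.sum_le_sum fun j _ => hleaf i j
  have hcenter : 2 - 2 / δ * (2 - (f (0, none) + f (1, none))) ≤
      (contribution (unitWeights (doubleStar k)) f (0, none) - 1) *
        (if 1 - δ ≤ f (0, none) then 1 else 0) +
      (contribution (unitWeights (doubleStar k)) f (1, none) - 1) *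
        (if 1 - δ ≤ f (1, none) then 1 else 0) := by
    rw [contribution_center, contribution_center]
    have hL (i : Fin 2) : 0 ≤ ∑ j, f (i, some j) := Finset.sum_nonneg fun j _ => hf0 _
    have hL0 := hL 0
    have hL1 := hL 1
    have hx := hf1 (0, none)
    have hy := hf1 (1, none)
    have hx0 := hf0 (0, none)
    have hy0 := hf0 (1, none)
    set z := 2 - (f (0, none) + f (1, none)) with hz
    have hz0 : 0 ≤ z := by linarith
    have hδz : 2 * z ≤ 2 / δ * z := by
      refine mul_le_mul_of_nonneg_right ?_ hz0
      rw [le_div_iff₀ hδ0]; linarith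
    -- once a center is below `1 - δ`, the left side is at most `δ - z ≤ 0`
    have hbig (h : δ ≤ z) : 2 + (z - δ) ≤ 2 / δ * z := by
      rw [div_mul_eq_mul_div, le_div_iff₀ hδ0]
      nlinarith
    split_ifs with h0 h1 h1
    · linarith
    · linarith [hbig (by linarith)]
    · linarith [hbig (by linarith)]
    · linarith [hbig (by linarith)]
  rw [sum_doubleStarVertex f, sum_doubleStarVertex]
  linarith [hleaves 0, hleaves 1, mul_nonneg hδ0.le (hf0 (0, none)),
    mul_nonneg hδ0.le (hf0 (1, none))]

/-- Every persuasive scheme on the double star costs at least `√n / 17`. -/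
lemma le_cost_doubleStar (hk : 1 ≤ k) (φ : SignalingScheme (DoubleStarVertex k))
    (hφ : φ.Persuasive (unitWeights (doubleStar k))) :
    1 / 17 * √(2 * k + 2 : ℝ) ≤ φ.cost := by
  have hk1 : (1 : ℝ) ≤ k := by exact_mod_cast hk
  have hf0 (s : DoubleStarVertex k → φ.signals) (v) : 0 ≤ (s v : ℝ) :=
    (φ.signals_mem _ (s v).2).1
  have hf1 (s : DoubleStarVertex k → φ.signals) (v) : (s v : ℝ) ≤ 1 :=
    (φ.signals_mem _ (s v).2).2
  have hW := unitWeights_self (doubleStar k)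
  set X : ℝ := φ.expect fun s => 2 - ((s (0, none) : ℝ) + s (1, none)) with hX
  set r := √(k + 2 : ℝ) with hr
  have hr2 : r ^ 2 = k + 2 := Real.sq_sqrt (by linarith)
  have hr0 : 0 < r := Real.sqrt_pos.mpr (by linarith)
  have hr1 : 1 ≤ r := by nlinarith
  have hlin (a b c : ℝ) : φ.expect (fun s => a + (b * (2 - ((s (0, none) : ℝ) + s (1, none))) +
      c * ∑ v, (s v : ℝ))) = a + b * X + c * φ.cost := by
    have h1 := φ.expect_const_mul a fun _ => 1
    simp only [mul_one, φ.expect_one] at h1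
    rw [φ.expect_add, φ.expect_add, φ.expect_const_mul, φ.expect_const_mul, h1,
      φ.cost_eq_expect]
    ring
  have hpos := hφ.expect_nonneg hW
  -- the centers have to be sent nearly one on average
  have hcenters : 0 ≤ 2 + -(k + 2) * X + 2 * φ.cost := by
    rw [← hlin]
    refine hpos.trans (φ.expect_mono fun s => ?_)
    rw [sum_contribution_sub_one, sum_doubleStarVertex]
    have := hf0 s (0, none)
    have := hf0 s (1, none)
    nlinarith
  have hcost1 : 0 ≤ -(2 * k + 2) + 0 * X + (k + 2) * φ.cost := by
    rw [← hlin]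
    refine hpos.trans (φ.expect_mono fun s => ?_)
    rw [sum_contribution_sub_one, sum_doubleStarVertex]
    have h (i : Fin 2) : 0 ≤ ∑ j, (s (i, some j) : ℝ) := Finset.sum_nonneg fun j _ => hf0 s _
    nlinarith [h 0, h 1]
  have hC : 1 ≤ φ.cost := by nlinarith
  -- the window `δ` balances the two error terms `X / δ` and `δ * cost`
  have hδ0 : 0 < 1 / (2 * r) := by positivity
  have hδ : 1 / (2 * r) ≤ 1 / 2 := by
    rw [div_le_div_iff₀ (by positivity) two_pos]; linarith
  have hhigh : 2 + -(2 / (1 / (2 * r))) * X + -(2 * (1 / (2 * r))) * φ.cost ≤ 0 := by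
    rw [← hlin, ← hφ.expect_eq_zero hW (g := fun θ => if 1 - 1 / (2 * r) ≤ θ then 1 else 0)
      (if_neg (by linarith))]
    refine φ.expect_mono fun s => le_trans (le_of_eq ?_)
      (le_sum_excess_high (hf0 s) (hf1 s) hδ0 hδ)
    ring
  have hX4 : r ^ 2 * X ≤ 4 * φ.cost := by rw [hr2]; linarith
  have h1 : 2 * r ≤ 17 * φ.cost := by
    have e1 : 2 / (1 / (2 * r)) = 4 * r := by field_simp; norm_num
    have e2 : r * (2 * (1 / (2 * r))) = 1 := by field_simp
    rw [e1] at hhigh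
    nlinarith [mul_le_mul_of_nonneg_left hhigh hr0.le]
  have h2 : √(2 * k + 2 : ℝ) ≤ 2 * r := by
    rw [Real.sqrt_le_left (by positivity)]
    nlinarith
  linarith

end DoubleStar

end

end Collab

theorem theorem1 :
    (∃ C : ℝ, 0 < C ∧ ∀ (V : Type u) [Fintype V] [DecidableEq V] (G : SimpleGraph V),
      ∃ φ : Collab.SignalingScheme V,
        φ.IsBinary ∧ φ.Persuasive (Collab.unitWeights G) ∧
          φ.cost ≤ C * (√(Fintype.card V : ℝ) * Collab.OPT (Collab.unitWeights G))) ∧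
    (∃ c : ℝ, 0 < c ∧ ∀ k : ℕ, 1 ≤ k →
      Collab.OPT (Collab.unitWeights (Collab.doubleStar k)) = 2 ∧
        ∀ φ : Collab.SignalingScheme (Collab.DoubleStarVertex k),
          φ.Persuasive (Collab.unitWeights (Collab.doubleStar k)) →
            c * √(2 * k + 2 : ℝ) ≤ φ.cost) := by
  refine ⟨⟨12, by norm_num, fun V _ _ G => Collab.exists_binary_scheme_cost_le G⟩,
    1 / 17, by norm_num, fun k hk => ⟨Collab.OPT_doubleStar hk, Collab.le_cost_doubleStar hk⟩⟩
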